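/- Fix an integer $r\ge 2$, exponents $\gamma_1,\dots,\gamma_r>0$, $\alpha\in(0,1]$, and constants $0<c_1\le c_2$, $R$, $\omega_0>0$, $\omega_1$. **Model.** For each $n$ one observes $(t_i,\mathbf x_i,y_i)$, $1\le i\le n$, with $$y_i=\sum_{l=1}^r\beta_l(t_i)x_{li}+\sigma\varepsilon_i ,$$ where the pairs $(t_i,\mathbf x_i)$ are i.i.d. copies of $(t,\mathbf X)$ with a known law, $t$ has a probability density $h$ on $(0,\infty)$ with $h>0$ almost everywhere, $|X_l|\le R$ almost surely (so $\mathbb E X_l^2<\infty$), and the eigenvalues of $\mathbf W=(\mathbb E[X_lX_m])_{l,m}$ lie in $[\omega_0,\omega_1]$. The noise $(\varepsilon_1,\dots,\varepsilon_n)$ is a centred Gaussian vector, independent of the design, with known covariance matrix $\Sigma_n$, which may depend on $n$ in an arbitrary way (in particular it may be that of $n$ consecutive terms of a stationary sequence depending on $n$), and for every $n$ $$c_1n^{1-\alpha}\le\lambda_{\min}(\Sigma_n)\le\lambda_{\max}(\Sigma_n)\le c_2n^{1-\alpha}.$$ **Function classes.** Let $\phi_k(t)=e^{-t/2}L_k(t)$,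 $k\ge0$, be the Laguerre functions ($L_k$ the Laguerre polynomials), and $\tilde\phi_k=\phi_k/\sqrt h$, which are orthonormal in $L^2((0,\infty),h\,dt)$. For $\gamma,A>0$ let $$B_h^{\gamma}(A)=\Big\{\beta\in L^2((0,\infty),h\,dt):\ \sum_{k\ge0}(k\vee1)^{2\gamma}\theta_k^2\le A^2,\ \ \theta_k=\int_0^\infty\beta\,\tilde\phi_k\,h\,dt\Big\},$$ $$B^{\gamma}(A)=\Big\{\beta\in L^2((0,\infty),dt):\ \sum_{k\ge0}(k\vee1)^{2\gamma}\theta_k^2\le A^2,\ \ \theta_k=\int_0^\infty\beta\,\phi_k\,dt\Big\}.$$ **Theorem.** There is a constant $C>0$, depending only on $r$, $\gamma_1,\dots,\gamma_r$, $\alpha$, $c_1$, $c_2$, $R$, $\omega_0$, $\omega_1$, such that for every design law and every sequence $(\Sigma_n)$ as above, every $\sigma>0$ and all $A_1,\dots,A_r>0$, one has for all sufficiently large $n$ $$\inf_{\hat{\boldsymbol\beta}}\ \sup_{\beta_l\in B_h^{\gamma_l}(A_l),\,1\le l\le r}\ \mathbb E\sum_{l=1}^r\int_0^\infty\big(\hat\beta_l(t)-\beta_l(t)\big)^2h(t)\,dt\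 \ge\ C\sum_{l=1}^rA_l^2\Big[\frac{\sigma^2}{A_l^2n^\alpha}\Big]^{\frac{2\gamma_l}{2\gamma_l+1}},$$ and likewise $$\inf_{\hat{\boldsymbol\beta}}\ \sup_{\beta_l\in B^{\gamma_l}(A_l),\,1\le l\le r}\ \mathbb E\sum_{l=1}^r\int_0^\infty\big(\hat\beta_l(t)-\beta_l(t)\big)^2dt\ \ge\ C\sum_{l=1}^rA_l^2\Big[\frac{\sigma^2}{A_l^2n^\alpha}\Big]^{\frac{2\gamma_l}{2\gamma_l+1}} .$$ Here the infima are over all estimators, i.e. all functions $\hat\beta_l(t)$ of the data and of $t$ that are jointly measurable (they may depend on $\sigma,\Sigma_n,\gamma_l,A_l$ and the law of the design). -/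

import Mathlib

open MeasureTheory ProbabilityTheory Set Filter
open scoped ENNReal

noncomputable section

namespace VaryingCoeff

/-- The Laguerre polynomial `L_k(t) = ∑_{j ≤ k} (-1)^j (k choose j) t^j / j!`. -/
def laguerrePoly (k : ℕ) (t : ℝ) : ℝ :=
  ∑ j ∈ Finset.range (k + 1), (-1 : ℝ) ^ j * (k.choose j : ℝ) * t ^ j / (j.factorial : ℝ)

/-- The Laguerre function `φ_k(t) = e^{-t/2} L_k(t)`. -/
def laguerreFun (k : ℕ) (t : ℝ) : ℝ := Real.exp (-t / 2) * laguerrePoly k t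

/-- The normalised Laguerre function `φ_k(t) / √h(t)`, orthonormal in `L²((0,∞), h(t) dt)`. -/
def laguerreFunTilde (h : ℝ → ℝ) (k : ℕ) (t : ℝ) : ℝ := laguerreFun k t / Real.sqrt (h t)

/-- Lebesgue measure on `(0,∞)`. -/
def halfLine : Measure ℝ := volume.restrict (Ioi 0)

/-- The measure `h(t) dt` on `(0,∞)`. -/
def timeLaw (h : ℝ → ℝ) : Measure ℝ := halfLine.withDensity (fun t => ENNReal.ofReal (h t))

/-- The Laguerre–Sobolev ball of smoothness `γ` and radius `A` for the system `e` in `L²(m)`: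
the `β ∈ L²(m)` with `∑_k (k ∨ 1)^{2γ} θ_k² ≤ A²`, where `θ_k = ∫ β e_k dm`. -/
def sobolevBall (m : Measure ℝ) (e : ℕ → ℝ → ℝ) (γ A : ℝ) : Set (ℝ → ℝ) :=
  {β | Measurable β ∧ MemLp β 2 m ∧
    ∑' k : ℕ, ENNReal.ofReal (((max k 1 : ℕ) : ℝ) ^ (2 * γ) * (∫ t, β t * e k t ∂m) ^ 2)
      ≤ ENNReal.ofReal (A ^ 2)}

/-- The second-moment matrix `E[X_l X_m]` of the covariates, `ν` being the law of `(t, X)`. -/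
def secondMoment {r : ℕ} (ν : Measure (ℝ × (Fin r → ℝ))) : Matrix (Fin r) (Fin r) ℝ :=
  Matrix.of fun l m => ∫ p, p.2 l * p.2 m ∂ν

/-- `ν` is an admissible law of a design point `(t, X)`. -/
structure IsDesignLaw {r : ℕ} (ν : Measure (ℝ × (Fin r → ℝ))) (h : ℝ → ℝ) (R ω₀ ω₁ : ℝ) :
    Prop where
  isProbability : IsProbabilityMeasure ν
  measurable_density : Measurable h
  density_pos : ∀ᵐ t ∂halfLine, 0 < h t
  /-- The time covariate takes values in `(0,∞)` and has density `h` there. -/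
  law_time : ν.map Prod.fst = timeLaw h
  /-- The covariates are compactly supported. -/
  bounded : ∀ᵐ p ∂ν, ∀ l, |p.2 l| ≤ R
  /-- The covariates have finite second moments. -/
  sq_integrable : ∀ l, Integrable (fun p : ℝ × (Fin r → ℝ) => p.2 l ^ 2) ν
  /-- The eigenvalues of the second-moment matrix lie in `[ω₀, ω₁]`. -/
  eigenvalues : ∀ x : ℝ, Module.End.HasEigenvalue (Matrix.toLin' (secondMoment ν)) x →
    ω₀ ≤ x ∧ x ≤ ω₁

/-- Long-memory condition: `S n` is an `n × n` covariance matrix all of whose eigenvalues lie in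
`[c₁ n^{1-α}, c₂ n^{1-α}]`, for every `n`. -/
def IsLongMemory (S : (n : ℕ) → Matrix (Fin n) (Fin n) ℝ) (α c₁ c₂ : ℝ) : Prop :=
  ∀ n, (S n).PosSemidef ∧
    ∀ x : ℝ, Module.End.HasEigenvalue (Matrix.toLin' (S n)) x →
      c₁ * (n : ℝ) ^ (1 - α) ≤ x ∧ x ≤ c₂ * (n : ℝ) ^ (1 - α)

/-- The data set: the `n` observations `((t_i, x_i), y_i)`. -/
abbrev Data (r n : ℕ) : Type := Fin n → (ℝ × (Fin r → ℝ)) × ℝ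

/-- The law of the data `((t_i, x_i), y_i)`, `i < n`, where
`y_i = ∑_l β_l(t_i) x_{li} + σ ε_i`, the `(t_i, x_i)` are i.i.d. with law `ν`, and `ε` is a centred
Gaussian vector with covariance matrix `S`, independent of the design. -/
def dataLaw {r : ℕ} (n : ℕ) (ν : Measure (ℝ × (Fin r → ℝ))) (S : Matrix (Fin n) (Fin n) ℝ)
    (σ : ℝ) (β : Fin r → ℝ → ℝ) : Measure (Data r n) :=
  ((Measure.pi fun _ : Fin n => ν).prod (multivariateGaussian 0 S)).map
    fun p i => (p.1 i, ∑ l, β l (p.1 i).1 * (p.1 i).2 l + σ * p.2 i)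

/-- The risk `E_β ∑_l ‖f_l - β_l‖²` in `L²(m)` of an estimator `f` of `β`. -/
def risk {r : ℕ} (m : Measure ℝ) (n : ℕ) (ν : Measure (ℝ × (Fin r → ℝ)))
    (S : Matrix (Fin n) (Fin n) ℝ) (σ : ℝ) (f : Data r n → Fin r → ℝ → ℝ)
    (β : Fin r → ℝ → ℝ) : ℝ≥0∞ :=
  ∫⁻ d, ∑ l, ∫⁻ t, ENNReal.ofReal ((f d l t - β l t) ^ 2) ∂m ∂(dataLaw n ν S σ β)

/-- The minimax risk over `Θ`: infimum over all jointly measurable estimators of the worst-case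
risk over `β ∈ Θ`. -/
def minimaxRisk {r : ℕ} (m : Measure ℝ) (n : ℕ) (ν : Measure (ℝ × (Fin r → ℝ)))
    (S : Matrix (Fin n) (Fin n) ℝ) (σ : ℝ) (Θ : Set (Fin r → ℝ → ℝ)) : ℝ≥0∞ :=
  ⨅ (f : Data r n → Fin r → ℝ → ℝ)
    (_ : ∀ l, Measurable fun q : Data r n × ℝ => f q.1 l q.2),
    ⨆ β ∈ Θ, risk m n ν S σ f β

/-- The rate `∑_l A_l² [σ² / (A_l² n^α)]^{2γ_l / (2γ_l + 1)}`. -/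
def rate {r : ℕ} (γ A : Fin r → ℝ) (α σ : ℝ) (n : ℕ) : ℝ :=
  ∑ l, A l ^ 2 * (σ ^ 2 / (A l ^ 2 * (n : ℝ) ^ α)) ^ (2 * γ l / (2 * γ l + 1))

end VaryingCoeff

end

noncomputable section
namespace VaryingCoeff

/-! ### Laguerre functions -/

/-! The bound is Assouad's cube argument applied to one coefficient at a time; since the risk then
exceeds each summand of the rate up to a constant, it exceeds their average (`ofReal_mul_sum_le`).
For fixed `l`, all coefficients are zero except `β_l = δ ∑ ω_k ψ_k`, with `ω ∈ {0,1}^M` and `ψ_k`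
the difference of two consecutive basis functions with indices in `[2M, 4M)`. By Bessel the loss
splits into `M` terms, each depending on one `ω_k`. Flipping `ω_k` costs order `δ²` as long as the
two data laws cannot be told apart (`dataLaw_two_point`), so the risk is at least `Mδ²/4`
(`ofReal_le_minimaxRisk`). Given the design, the flip translates the noise by a vector `w`. Since
the covariance dominates `c = c₁ n^{1-α}`, the translation is harmless when `E‖w‖²` is a small
multiple of `c`, that is, `δ²` is of order `σ² n^{-α}`; this is where `n^α` replaces `n`. Membership
in the ball asks for `M^{2γ+1} δ²` of order `A²`. Balancing the two gives the rate
(`exists_level_amplitude`). The size of the translation is governed by `∫ ψ_k² h`, which must be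
bounded uniformly in `h` also when the loss is unweighted. This is why differences are used:
`laguerreCorr` gives `(φ_{k+1} - φ_k)² ≤ 1` on the half-line by an elementary monotonicity argument,
which also yields orthonormality. -/

lemma laguerrePoly_succ_sub (m : ℕ) (t : ℝ) :
    laguerrePoly (m + 1) t - laguerrePoly m t =
      ∑ j ∈ Finset.range (m + 1),
        (-1 : ℝ) ^ (j + 1) * (m.choose j : ℝ) * t ^ (j + 1) / ((j + 1).factorial : ℝ) := by
  -- The added term vanishes because `m.choose (m + 1) = 0`; Pascal's rule then cancels termwise.
  have h₁ : laguerrePoly m t = ∑ j ∈ Finset.range (m + 1 + 1),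
      (-1 : ℝ) ^ j * (m.choose j : ℝ) * t ^ j / (j.factorial : ℝ) := by
    rw [Finset.sum_range_succ, laguerrePoly]
    simp
  rw [h₁, laguerrePoly, Finset.sum_range_succ', Finset.sum_range_succ' _ (m + 1)]
  simp only [Nat.choose_succ_succ, Nat.cast_add, Nat.choose_zero_right, add_sub_add_right_eq_sub]
  rw [← Finset.sum_sub_distrib]
  exact Finset.sum_congr rfl fun j _ => by ring

lemma hasDerivAt_laguerrePoly_succ_sub (m : ℕ) (t : ℝ) :
    HasDerivAt (fun t => laguerrePoly (m + 1) t - laguerrePoly m t) (-laguerrePoly m t) t := by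
  simp_rw [laguerrePoly_succ_sub]
  have h : -laguerrePoly m t = ∑ j ∈ Finset.range (m + 1),
      (-1 : ℝ) ^ (j + 1) * (m.choose j : ℝ) * (((j + 1 : ℕ) : ℝ) * t ^ j)
        / ((j + 1).factorial : ℝ) := by
    rw [laguerrePoly, ← Finset.sum_neg_distrib]
    refine Finset.sum_congr rfl fun j _ => ?_
    have : (j.factorial : ℝ) ≠ 0 := by positivity
    rw [Nat.factorial_succ]
    push_cast
    field_simp
    ring
  rw [h]
  refine HasDerivAt.fun_sum fun j _ => ?_
  simpa using ((hasDerivAt_pow (j + 1) t).const_mul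
    ((-1 : ℝ) ^ (j + 1) * (m.choose j : ℝ))).div_const ((j + 1).factorial : ℝ)

lemma laguerreFun_apply_zero (k : ℕ) : laguerreFun k 0 = 1 := by
  simp [laguerreFun, laguerrePoly, Finset.sum_range_succ', zero_pow]

lemma continuous_laguerreFun (k : ℕ) : Continuous (laguerreFun k) := by
  unfold laguerreFun laguerrePoly
  fun_prop

lemma measurable_laguerreFun (k : ℕ) : Measurable (laguerreFun k) :=
  (continuous_laguerreFun k).measurable

lemma tendsto_laguerreFun_atTop (k : ℕ) : Tendsto (laguerreFun k) atTop (nhds 0) := by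
  have h : ∀ j : ℕ, Tendsto (fun t : ℝ => Real.exp (-t / 2) * t ^ j) atTop (nhds 0) := fun j => by
    have := (Real.tendsto_pow_mul_exp_neg_atTop_nhds_zero j).comp
      (tendsto_id.atTop_div_const (r := (2 : ℝ)) (by norm_num))
    have := this.const_mul (2 ^ j)
    rw [mul_zero] at this
    refine this.congr fun t => ?_
    simp only [Function.comp_apply, id, div_pow, neg_div]
    field_simp
  have : laguerreFun k = fun t => ∑ j ∈ Finset.range (k + 1),
      ((-1 : ℝ) ^ j * (k.choose j : ℝ) / (j.factorial : ℝ)) * (Real.exp (-t / 2) * t ^ j) := by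
    ext t
    rw [laguerreFun, laguerrePoly, Finset.mul_sum]
    exact Finset.sum_congr rfl fun j _ => by ring
  rw [this]
  have := tendsto_finsetSum (Finset.range (k + 1)) fun j _ =>
    (h j).const_mul ((-1 : ℝ) ^ j * (k.choose j : ℝ) / (j.factorial : ℝ))
  simpa using this

/-- The function `φ_{k-1}`, with the convention `φ_{-1} = 0`. -/
def laguerreFunPred : ℕ → ℝ → ℝ
  | 0, _ => 0
  | k + 1, t => laguerreFun k t

/-- The increment `φ_k - φ_{k-1}`, with the convention `φ_{-1} = 0`. -/
def laguerreFunDiff (k : ℕ) (t : ℝ) : ℝ := laguerreFun k t - laguerreFunPred k t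

/-- The exponential factor symmetrises `L_{m+1}' - L_m' = -L_m`: differences differentiate to sums,
so that products of increments will have derivatives of telescoping form. -/
lemma hasDerivAt_laguerreFunDiff (k : ℕ) (t : ℝ) :
    HasDerivAt (laguerreFunDiff k) (-(laguerreFun k t + laguerreFunPred k t) / 2) t := by
  have he : HasDerivAt (fun t : ℝ => Real.exp (-t / 2)) (Real.exp (-t / 2) * (-1 / 2)) t :=
    ((hasDerivAt_id t).neg.div_const 2).exp
  cases k with
  | zero =>
    have hf : laguerreFunDiff 0 = fun t : ℝ => Real.exp (-t / 2) := by
      ext s; simp [laguerreFunDiff, laguerreFunPred, laguerreFun, laguerrePoly]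
    rw [hf]
    refine he.congr_deriv ?_
    simp [laguerreFunPred, laguerreFun, laguerrePoly]
    ring
  | succ m =>
    have hf : laguerreFunDiff (m + 1) = (fun t : ℝ => Real.exp (-t / 2)) *
        fun t => laguerrePoly (m + 1) t - laguerrePoly m t := by
      ext s; simp only [laguerreFunDiff, laguerreFunPred, laguerreFun, Pi.mul_apply]; ring
    rw [hf]
    refine (he.mul (hasDerivAt_laguerrePoly_succ_sub m t)).congr_deriv ?_
    simp only [laguerreFunPred, laguerreFun]
    ring

lemma laguerreFunDiff_apply_zero (k : ℕ) : laguerreFunDiff k 0 = if k = 0 then 1 else 0 := by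
  cases k <;> simp [laguerreFunDiff, laguerreFunPred, laguerreFun_apply_zero]

lemma tendsto_laguerreFunDiff_atTop (k : ℕ) : Tendsto (laguerreFunDiff k) atTop (nhds 0) := by
  have h : Tendsto (laguerreFunPred k) atTop (nhds 0) := by
    cases k with
    | zero => exact tendsto_const_nhds
    | succ m => exact tendsto_laguerreFun_atTop m
  have := (tendsto_laguerreFun_atTop k).sub h
  rw [sub_zero] at this
  exact this

/-- The correlation at lag `a` of the first `K + 1` increments of the Laguerre functions. -/
def laguerreCorr (K a : ℕ) (t : ℝ) : ℝ :=
  ∑ k ∈ Finset.range (K + 1), laguerreFunDiff k t * laguerreFunDiff (k + a) t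

/-- The derivative of the `k`-th product is `φ_{k-1} φ_{k+a-1} - φ_k φ_{k+a}`, so the sum
telescopes. This explicit primitive of `-φ_K φ_{K+a}` yields integrability, orthonormality and a sup
bound. -/
lemma hasDerivAt_laguerreCorr (K a : ℕ) (t : ℝ) :
    HasDerivAt (laguerreCorr K a) (-(laguerreFun K t * laguerreFun (K + a) t)) t := by
  induction K with
  | zero =>
    have hf : laguerreCorr 0 a = laguerreFunDiff 0 * laguerreFunDiff a := by
      ext s; simp [laguerreCorr]
    rw [hf]
    refine ((hasDerivAt_laguerreFunDiff 0 t).mul (hasDerivAt_laguerreFunDiff a t)).congr_deriv ?_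
    simp only [laguerreFunDiff, laguerreFunPred, zero_add]
    ring
  | succ K ih =>
    have hf : laguerreCorr (K + 1) a =
        laguerreCorr K a + laguerreFunDiff (K + 1) * laguerreFunDiff (K + 1 + a) := by
      ext s; simp [laguerreCorr, Finset.sum_range_succ _ (K + 1)]
    rw [hf]
    refine (ih.add ((hasDerivAt_laguerreFunDiff (K + 1) t).mul
      (hasDerivAt_laguerreFunDiff (K + 1 + a) t))).congr_deriv ?_
    simp only [laguerreFunDiff, laguerreFunPred, Nat.add_right_comm K 1 a]
    ring

lemma laguerreCorr_apply_zero (K a : ℕ) : laguerreCorr K a 0 = if a = 0 then 1 else 0 := by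
  simp only [laguerreCorr, laguerreFunDiff_apply_zero]
  rw [Finset.sum_eq_single 0] <;> simp +contextual

lemma tendsto_laguerreCorr_atTop (K a : ℕ) : Tendsto (laguerreCorr K a) atTop (nhds 0) := by
  have := tendsto_finsetSum (Finset.range (K + 1)) fun k _ =>
    (tendsto_laguerreFunDiff_atTop k).mul (tendsto_laguerreFunDiff_atTop (k + a))
  simp only [mul_zero, Finset.sum_const_zero] at this
  exact this

/-- At lag `0`, `-φ_k²` is a derivative of constant sign whose primitive converges at infinity. -/
lemma memLp_laguerreFun (k : ℕ) : MemLp (laguerreFun k) 2 halfLine := by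
  rw [memLp_two_iff_integrable_sq (measurable_laguerreFun k).aestronglyMeasurable]
  have h := integrableOn_Ioi_deriv_of_nonpos' (a := 0) (fun t _ => hasDerivAt_laguerreCorr k 0 t)
    (fun t _ => by simpa using mul_self_nonneg _) (tendsto_laguerreCorr_atTop k 0)
  refine (Integrable.neg h).congr (ae_of_all _ fun t => ?_)
  simp [sq]

lemma integral_laguerreFun_mul (j k : ℕ) :
    ∫ t, laguerreFun j t * laguerreFun k t ∂halfLine = if j = k then 1 else 0 := by
  wlog h : j ≤ k generalizing j k with H
  · simp_rw [mul_comm (laguerreFun j _), eq_comm (a := j)]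
    exact H k j (by omega)
  obtain ⟨a, rfl⟩ := Nat.exists_eq_add_of_le h
  have hi : IntegrableOn (fun t => -(laguerreFun j t * laguerreFun (j + a) t)) (Ioi 0) :=
    ((memLp_laguerreFun j).integrable_mul (memLp_laguerreFun (j + a))).neg
  have := integral_Ioi_of_hasDerivAt_of_tendsto' (fun t _ => hasDerivAt_laguerreCorr j a t) hi
    (tendsto_laguerreCorr_atTop j a)
  rw [integral_neg, laguerreCorr_apply_zero, zero_sub, neg_inj] at this
  rw [halfLine, this]
  simp

/-- At lag `0` the correlation is a sum of squares of increments, it decreases in `t`, and it equals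
`1` at `0`; each square is therefore at most `1`. -/
lemma sq_laguerreFun_succ_sub_le_one (k : ℕ) {t : ℝ} (ht : 0 ≤ t) :
    (laguerreFun (k + 1) t - laguerreFun k t) ^ 2 ≤ 1 := by
  have hanti : Antitone (laguerreCorr (k + 1) 0) :=
    antitone_of_hasDerivAt_nonpos (hasDerivAt_laguerreCorr (k + 1) 0)
      fun s => by simpa using mul_self_nonneg _
  have h₁ := hanti ht
  rw [laguerreCorr_apply_zero, if_pos rfl] at h₁
  refine le_trans ?_ h₁
  have := Finset.single_le_sum
    (f := fun k => laguerreFunDiff k t * laguerreFunDiff (k + 0) t)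
    (fun i _ => mul_self_nonneg _) (Finset.self_mem_range_succ (k + 1))
  simpa [laguerreFunDiff, laguerreFunPred, sq, laguerreCorr] using this

/-! ### Laguerre functions normalised by the design density -/

lemma measurable_laguerreFunTilde {h : ℝ → ℝ} (hh : Measurable h) (k : ℕ) :
    Measurable (laguerreFunTilde h k) :=
  (measurable_laguerreFun k).div hh.sqrt

lemma integral_timeLaw {h : ℝ → ℝ} (hh : Measurable h) (hpos : ∀ᵐ t ∂halfLine, 0 < h t)
    (f : ℝ → ℝ) : ∫ t, f t ∂timeLaw h = ∫ t, h t * f t ∂halfLine := by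
  rw [timeLaw, integral_withDensity_eq_integral_toReal_smul hh.ennreal_ofReal (by simp)]
  refine integral_congr_ae ?_
  filter_upwards [hpos] with t ht
  simp [ENNReal.toReal_ofReal ht.le]

lemma memLp_laguerreFunTilde {h : ℝ → ℝ} (hh : Measurable h) (hpos : ∀ᵐ t ∂halfLine, 0 < h t)
    (k : ℕ) : MemLp (laguerreFunTilde h k) 2 (timeLaw h) := by
  rw [memLp_two_iff_integrable_sq (measurable_laguerreFunTilde hh k).aestronglyMeasurable, timeLaw,
    integrable_withDensity_iff_integrable_smul' hh.ennreal_ofReal (by simp)]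
  refine ((memLp_laguerreFun k).integrable_sq).congr ?_
  filter_upwards [hpos] with t ht
  rw [ENNReal.toReal_ofReal ht.le, laguerreFunTilde, div_pow, Real.sq_sqrt ht.le, smul_eq_mul]
  field_simp

lemma integral_laguerreFunTilde_mul {h : ℝ → ℝ} (hh : Measurable h)
    (hpos : ∀ᵐ t ∂halfLine, 0 < h t) (j k : ℕ) :
    ∫ t, laguerreFunTilde h j t * laguerreFunTilde h k t ∂timeLaw h = if j = k then 1 else 0 := by
  rw [integral_timeLaw hh hpos, ← integral_laguerreFun_mul]
  refine integral_congr_ae ?_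
  filter_upwards [hpos] with t ht
  have := Real.mul_self_sqrt ht.le
  have h' : Real.sqrt (h t) ≠ 0 := (Real.sqrt_pos.2 ht).ne'
  rw [laguerreFunTilde, laguerreFunTilde]
  field_simp
  rw [Real.sq_sqrt ht.le]
  ring

/-! ### Shifts of Gaussian measures -/

lemma pi_withDensity_prod {ι : Type*} [Fintype ι] {X : ι → Type*} [∀ i, MeasurableSpace (X i)]
    (μ : ∀ i, Measure (X i)) [∀ i, IsProbabilityMeasure (μ i)] {f : ∀ i, X i → ℝ≥0∞}
    (hf : ∀ i, Measurable (f i)) [∀ i, SigmaFinite ((μ i).withDensity (f i))] :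
    (Measure.pi μ).withDensity (fun x => ∏ i, f i (x i)) =
      Measure.pi fun i => (μ i).withDensity (f i) := by
  symm
  refine Measure.pi_eq fun s hs => ?_
  rw [withDensity_apply _ (MeasurableSet.univ_pi hs),
    ← lintegral_indicator (MeasurableSet.univ_pi hs)]
  have hm : ∀ i, Measurable ((s i).indicator (f i)) := fun i => (hf i).indicator (hs i)
  have h₁ : ∀ x : ∀ i, X i, (Set.univ.pi s).indicator (fun x => ∏ i, f i (x i)) x =
      ∏ i, (s i).indicator (f i) (x i) := fun x => by
    by_cases hx : x ∈ Set.univ.pi s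
    · rw [indicator_of_mem hx]
      exact Finset.prod_congr rfl fun i _ => (indicator_of_mem (hx i trivial) _).symm
    · rw [indicator_of_notMem hx]
      simp only [Set.mem_univ_pi, not_forall] at hx
      obtain ⟨i, hi⟩ := hx
      exact (Finset.prod_eq_zero (Finset.mem_univ i) (indicator_of_notMem hi _)).symm
  simp_rw [h₁]
  have hind := iIndepFun_pi (μ := μ) (X := fun i => (s i).indicator (f i))
    fun i => (hm i).aemeasurable
  have h₂ := lintegral_prod_eq_prod_lintegral_of_indepFun Finset.univ _ hind
    fun i => (hm i).comp (measurable_pi_apply i)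
  rw [h₂]
  refine Finset.prod_congr rfl fun i _ => ?_
  rw [withDensity_apply _ (hs i), ← lintegral_indicator (hs i),
    ← (measurePreserving_eval μ i).lintegral_comp (hm i)]

lemma gaussianReal_eq_withDensity_exp (u : ℝ) :
    gaussianReal u 1 =
      (gaussianReal 0 1).withDensity fun x => ENNReal.ofReal (Real.exp (u * x - u ^ 2 / 2)) := by
  rw [gaussianReal_of_var_ne_zero _ one_ne_zero, gaussianReal_of_var_ne_zero _ one_ne_zero,
    ← withDensity_mul _ (measurable_gaussianPDF 0 1) (by fun_prop)]
  congr 1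
  ext x
  rw [Pi.mul_apply, gaussianPDF, gaussianPDF,
    ← ENNReal.ofReal_mul (gaussianPDFReal_nonneg _ _ _), gaussianPDFReal, gaussianPDFReal,
    mul_assoc _ (Real.exp _), ← Real.exp_add]
  congr 3
  simp only [NNReal.coe_one]
  ring

/-- The Cameron–Martin formula: the one-dimensional likelihood ratios multiply over the independent
coordinates. -/
lemma lintegral_stdGaussian_add {n : ℕ} {H : EuclideanSpace ℝ (Fin n) → ℝ≥0∞} (hH : Measurable H)
    (u : EuclideanSpace ℝ (Fin n)) :
    ∫⁻ g, H (g + u) ∂stdGaussian (EuclideanSpace ℝ (Fin n)) =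
      ∫⁻ g, H g * ENNReal.ofReal (Real.exp (inner ℝ u g - ‖u‖ ^ 2 / 2))
        ∂stdGaussian (EuclideanSpace ℝ (Fin n)) := by
  set γ : Measure (Fin n → ℝ) := Measure.pi fun _ => gaussianReal 0 1 with hγ
  have hsig : ∀ i, SigmaFinite ((gaussianReal 0 1).withDensity
      fun x => ENNReal.ofReal (Real.exp (u i * x - u i ^ 2 / 2))) := fun i => by
    rw [← gaussianReal_eq_withDensity_exp]; infer_instance
  have hshift : γ.map (fun x i => x i + u i) = γ.withDensity
      fun x => ∏ i, ENNReal.ofReal (Real.exp (u i * x i - u i ^ 2 / 2)) := by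
    rw [hγ, pi_withDensity_prod (μ := fun _ : Fin n => gaussianReal 0 1)
      (f := fun i x => ENNReal.ofReal (Real.exp (u i * x - u i ^ 2 / 2))) (fun i => by fun_prop),
      Measure.pi_map_pi (μ := fun _ : Fin n => gaussianReal 0 1) (f := fun i x => x + u i)
        (fun i => by fun_prop)]
    congr 1
    ext1 i
    rw [← gaussianReal_eq_withDensity_exp, gaussianReal_map_add_const, zero_add]
  have hL : Measurable (fun x : Fin n → ℝ => H (WithLp.toLp 2 x)) :=
    hH.comp (WithLp.measurable_toLp 2 _)
  rw [← map_pi_eq_stdGaussian, lintegral_map (by fun_prop) (by fun_prop),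
    lintegral_map (by fun_prop) (by fun_prop), ← hγ]
  have h₁ : ∫⁻ x, H (WithLp.toLp 2 x + u) ∂γ =
      ∫⁻ x, H (WithLp.toLp 2 x) ∂γ.map (fun x i => x i + u i) := by
    rw [lintegral_map hL (by fun_prop)]
    rfl
  rw [h₁, hshift, lintegral_withDensity_eq_lintegral_mul _ (by fun_prop) hL]
  refine lintegral_congr fun x => ?_
  rw [Pi.mul_apply, mul_comm, ← ENNReal.ofReal_prod_of_nonneg fun i _ => (Real.exp_pos _).le,
    ← Real.exp_sum, Finset.sum_sub_distrib, EuclideanSpace.real_norm_sq_eq, PiLp.inner_apply,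
    Finset.sum_div]
  simp [mul_comm]

lemma lintegral_inner_sq_stdGaussian {n : ℕ} (u : EuclideanSpace ℝ (Fin n)) :
    ∫⁻ g, ENNReal.ofReal (inner ℝ u g ^ 2) ∂stdGaussian (EuclideanSpace ℝ (Fin n)) =
      ENNReal.ofReal (‖u‖ ^ 2) := by
  have hv := variance_dual_stdGaussian (innerSL ℝ u)
  have hm : MemLp (innerSL ℝ u) 2 (stdGaussian (EuclideanSpace ℝ (Fin n))) :=
    IsGaussian.memLp_dual _ _ 2 (by simp)
  rw [variance_eq_integral hm.aemeasurable, integral_strongDual_stdGaussian,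
    innerSL_apply_norm] at hv
  rw [← hv, ofReal_integral_eq_lintegral_ofReal]
  · simp
  · simpa using hm.integrable_sq
  · exact ae_of_all _ fun _ => sq_nonneg _

/-- From `exp x ≥ 1 + x` and `1 + a + a² = (a + 1/2)² + 3/4`. It bounds the overlap of two
translates by second moments only. -/
lemma three_quarters_le_min_one_exp_add (a b : ℝ) :
    3 / 4 ≤ min 1 (Real.exp (a - b ^ 2 / 2)) + (a ^ 2 + b ^ 2 / 2) := by
  rcases le_total 1 (Real.exp (a - b ^ 2 / 2)) with h | h
  · rw [min_eq_left h]; nlinarith [sq_nonneg a, sq_nonneg b]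
  · rw [min_eq_right h]
    nlinarith [Real.add_one_le_exp (a - b ^ 2 / 2), sq_nonneg (a + 1 / 2)]

/-- Testing bound for two translates of a standard Gaussian. -/
lemma stdGaussian_two_point {n : ℕ} {H₀ H₁ : EuclideanSpace ℝ (Fin n) → ℝ≥0∞}
    (h₀ : Measurable H₀) (h₁ : Measurable H₁) {s : ℝ≥0∞} (hs : ∀ g, s ≤ H₀ g + H₁ g)
    (u : EuclideanSpace ℝ (Fin n)) :
    s * ENNReal.ofReal (3 / 4) ≤
      ∫⁻ g, H₀ g ∂stdGaussian (EuclideanSpace ℝ (Fin n)) +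
      ∫⁻ g, H₁ (g + u) ∂stdGaussian (EuclideanSpace ℝ (Fin n)) +
        s * ENNReal.ofReal (3 / 2 * ‖u‖ ^ 2) := by
  set P := stdGaussian (EuclideanSpace ℝ (Fin n))
  -- Both integrals are put under the same law by the likelihood ratio; the minimum of `1` and this
  -- ratio bounds both weights from below.
  have hpt : ∀ g, s * ENNReal.ofReal (3 / 4) ≤
      H₀ g + H₁ g * ENNReal.ofReal (Real.exp (inner ℝ u g - ‖u‖ ^ 2 / 2)) +
        s * ENNReal.ofReal (inner ℝ u g ^ 2 + ‖u‖ ^ 2 / 2) := fun g => by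
    set a : ℝ := inner ℝ u g
    set m := min 1 (Real.exp (a - ‖u‖ ^ 2 / 2))
    have hm0 : 0 ≤ m := le_min zero_le_one (Real.exp_pos _).le
    have hle : s * ENNReal.ofReal m ≤
        H₀ g + H₁ g * ENNReal.ofReal (Real.exp (a - ‖u‖ ^ 2 / 2)) := by
      calc s * ENNReal.ofReal m ≤ (H₀ g + H₁ g) * ENNReal.ofReal m := by gcongr; exact hs g
        _ = H₀ g * ENNReal.ofReal m + H₁ g * ENNReal.ofReal m := add_mul _ _ _
        _ ≤ H₀ g * 1 + H₁ g * ENNReal.ofReal (Real.exp (a - ‖u‖ ^ 2 / 2)) := by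
            gcongr
            · exact ENNReal.ofReal_le_one.2 (min_le_left _ _)
            · exact min_le_right _ _
        _ = _ := by rw [mul_one]
    calc s * ENNReal.ofReal (3 / 4)
        ≤ s * ENNReal.ofReal (m + (a ^ 2 + ‖u‖ ^ 2 / 2)) := by
          gcongr; exact three_quarters_le_min_one_exp_add a ‖u‖
      _ = s * ENNReal.ofReal m + s * ENNReal.ofReal (a ^ 2 + ‖u‖ ^ 2 / 2) := by
          rw [ENNReal.ofReal_add hm0 (by positivity), mul_add]
      _ ≤ _ := by gcongr
  have hint : ∫⁻ g, s * ENNReal.ofReal (inner ℝ u g ^ 2 + ‖u‖ ^ 2 / 2) ∂P =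
      s * ENNReal.ofReal (3 / 2 * ‖u‖ ^ 2) := by
    rw [lintegral_const_mul _ (by fun_prop)]
    simp_rw [fun g => ENNReal.ofReal_add (sq_nonneg (inner ℝ u g))
      (show 0 ≤ ‖u‖ ^ 2 / 2 by positivity)]
    rw [lintegral_add_left (by fun_prop), lintegral_inner_sq_stdGaussian, lintegral_const,
      measure_univ, mul_one, ← ENNReal.ofReal_add (by positivity) (by positivity)]
    congr 2
    ring
  calc s * ENNReal.ofReal (3 / 4) = ∫⁻ _, s * ENNReal.ofReal (3 / 4) ∂P := by simp
    _ ≤ _ := lintegral_mono hpt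
    _ = _ := by
      rw [lintegral_add_right _ (by fun_prop), lintegral_add_left h₀, hint,
        lintegral_stdGaussian_add h₁]

-- Since `S - c` is positive semidefinite, `‖√S u‖² = ⟨u, S u⟩ ≥ c ‖u‖²`. Hence `√S` is injective,
-- and surjective by finite dimension: every translation of correlated noise is the image of a
-- controlled translation of white noise.
open scoped MatrixOrder Matrix in
lemma exists_sqrt_apply_eq {n : ℕ} {S : Matrix (Fin n) (Fin n) ℝ} (hS : S.PosSemidef) {c : ℝ}
    (hc : 0 < c) (hev : ∀ x : ℝ, Module.End.HasEigenvalue (Matrix.toLin' S) x → c ≤ x)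
    (w : EuclideanSpace ℝ (Fin n)) :
    ∃ u, Matrix.toEuclideanCLM (𝕜 := ℝ) (CFC.sqrt S) u = w ∧ c * ‖u‖ ^ 2 ≤ ‖w‖ ^ 2 := by
  have hps : (S - algebraMap ℝ _ c).PosSemidef := by
    rw [Matrix.posSemidef_iff_isHermitian_and_spectrum_nonneg]
    refine ⟨hS.isHermitian.sub ?_, fun x hx => ?_⟩
    · rw [Matrix.algebraMap_eq_diagonal]
      exact Matrix.isHermitian_diagonal _
    · rw [sub_eq_add_neg, ← map_neg, ← spectrum.add_singleton_eq] at hx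
      obtain ⟨y, hy, z, hz, rfl⟩ := hx
      rw [← Matrix.spectrum_toLin', ← Module.End.hasEigenvalue_iff_mem_spectrum] at hy
      simp only [Set.mem_singleton_iff] at hz
      subst hz
      have := hev y hy
      simp only [Set.mem_ofPred_eq]
      linarith
  have key : ∀ u : EuclideanSpace ℝ (Fin n),
      c * ‖u‖ ^ 2 ≤ ‖Matrix.toEuclideanCLM (𝕜 := ℝ) (CFC.sqrt S) u‖ ^ 2 := fun u => by
    set B := Matrix.toEuclideanCLM (𝕜 := ℝ) (CFC.sqrt S) with hB
    have hself : IsSelfAdjoint B := (CFC.sqrt_nonneg S).isSelfAdjoint.map _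
    have h₁ : ‖B u‖ ^ 2 = u.ofLp ⬝ᵥ S *ᵥ u.ofLp := by
      rw [← real_inner_self_eq_norm_sq, ← ContinuousLinearMap.adjoint_inner_right,
        hself.adjoint_eq, ← ContinuousLinearMap.comp_apply, ← ContinuousLinearMap.mul_def, hB,
        ← map_mul, CFC.sqrt_mul_sqrt_self _ hS.nonneg, Matrix.inner_toEuclideanCLM]
    have h₂ := hps.dotProduct_mulVec_nonneg u.ofLp
    rw [Matrix.sub_mulVec, dotProduct_sub, star_trivial, Algebra.algebraMap_eq_smul_one,
      Matrix.smul_mulVec, Matrix.one_mulVec, dotProduct_smul, ← h₁] at h₂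
    have h₃ : u.ofLp ⬝ᵥ u.ofLp = ‖u‖ ^ 2 := by
      rw [EuclideanSpace.real_norm_sq_eq, dotProduct]
      simp [sq]
    rw [h₃, smul_eq_mul] at h₂
    linarith
  have hinj : Function.Injective (Matrix.toEuclideanCLM (𝕜 := ℝ) (CFC.sqrt S)) := by
    rw [injective_iff_map_eq_zero]
    intro u hu
    have := key u
    rw [hu, norm_zero] at this
    have : ‖u‖ ^ 2 ≤ 0 := by nlinarith
    simpa using this
  obtain ⟨u, rfl⟩ := (LinearMap.injective_iff_surjective (f := (Matrix.toEuclideanCLM (𝕜 := ℝ)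
    (CFC.sqrt S) : EuclideanSpace ℝ (Fin n) →ₗ[ℝ] EuclideanSpace ℝ (Fin n)))).1 hinj w
  exact ⟨u, rfl, key u⟩

open scoped MatrixOrder in
lemma multivariateGaussian_two_point {n : ℕ} {S : Matrix (Fin n) (Fin n) ℝ} (hS : S.PosSemidef)
    {c : ℝ} (hc : 0 < c) (hev : ∀ x : ℝ, Module.End.HasEigenvalue (Matrix.toLin' S) x → c ≤ x)
    {H₀ H₁ : EuclideanSpace ℝ (Fin n) → ℝ≥0∞}
    (h₀ : Measurable H₀) (h₁ : Measurable H₁) {s : ℝ≥0∞} (hs : ∀ g, s ≤ H₀ g + H₁ g)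
    (w : EuclideanSpace ℝ (Fin n)) :
    s * ENNReal.ofReal (3 / 4) ≤
      ∫⁻ g, H₀ g ∂multivariateGaussian 0 S + ∫⁻ g, H₁ (g + w) ∂multivariateGaussian 0 S +
        s * ENNReal.ofReal (3 / 2 * (‖w‖ ^ 2 / c)) := by
  obtain ⟨u, rfl, hu⟩ := exists_sqrt_apply_eq hS hc hev w
  set B := Matrix.toEuclideanCLM (𝕜 := ℝ) (CFC.sqrt S)
  rw [multivariateGaussian, lintegral_map h₀ (by fun_prop), lintegral_map (by fun_prop)
    (by fun_prop)]
  simp only [zero_add]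
  refine (stdGaussian_two_point (h₀.comp B.measurable) (h₁.comp B.measurable)
    (fun g => hs (B g)) u).trans ?_
  simp only [Function.comp_apply, map_add]
  gcongr
  rwa [le_div_iff₀ hc, mul_comm]

/-! ### Two-point bound for the law of the data -/

lemma measurable_dataMap {r n : ℕ} (σ : ℝ) {β : Fin r → ℝ → ℝ} (hβ : ∀ l, Measurable (β l)) :
    Measurable fun (p : (Fin n → ℝ × (Fin r → ℝ)) × EuclideanSpace ℝ (Fin n)) (i : Fin n) =>
      (p.1 i, ∑ l, β l (p.1 i).1 * (p.1 i).2 l + σ * p.2 i) := by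
  refine measurable_pi_lambda _ fun i => Measurable.prodMk (by fun_prop) ?_
  refine Measurable.add (Finset.measurable_fun_sum _ fun l _ => Measurable.mul ?_ ?_) (by fun_prop)
  · exact (hβ l).comp (by fun_prop)
  · fun_prop

/-- The Gaussian testing bound is applied conditionally on the design and then averaged, so only the
mean squared size of the translation matters. -/
lemma dataLaw_two_point {r n : ℕ} {ν : Measure (ℝ × (Fin r → ℝ))} [IsProbabilityMeasure ν]
    {S : Matrix (Fin n) (Fin n) ℝ} (hS : S.PosSemidef) {c : ℝ} (hc : 0 < c)
    (hev : ∀ x : ℝ, Module.End.HasEigenvalue (Matrix.toLin' S) x → c ≤ x)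
    {σ : ℝ} (hσ : 0 < σ) {β β' : Fin r → ℝ → ℝ} (hβ : ∀ l, Measurable (β l))
    (hβ' : ∀ l, Measurable (β' l)) {G₀ G₁ : Data r n → ℝ≥0∞} (h₀ : Measurable G₀)
    (h₁ : Measurable G₁) {s : ℝ≥0∞} (hs_top : s ≠ ∞) (hs : ∀ d, s ≤ G₀ d + G₁ d)
    (hclose : n * ∫⁻ p, ENNReal.ofReal ((∑ l, (β' l p.1 - β l p.1) * p.2 l) ^ 2) ∂ν ≤
      ENNReal.ofReal (c * σ ^ 2 / 6)) :
    s * ENNReal.ofReal (1 / 2) ≤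
      ∫⁻ d, G₀ d ∂dataLaw n ν S σ β + ∫⁻ d, G₁ d ∂dataLaw n ν S σ β' := by
  set Φ : (Fin r → ℝ → ℝ) → (Fin n → ℝ × (Fin r → ℝ)) × EuclideanSpace ℝ (Fin n) → Data r n :=
    fun β p i => (p.1 i, ∑ l, β l (p.1 i).1 * (p.1 i).2 l + σ * p.2 i) with hΦ
  have hm : Measurable (Φ β) := measurable_dataMap σ hβ
  have hm' : Measurable (Φ β') := measurable_dataMap σ hβ'
  set D : ℝ × (Fin r → ℝ) → ℝ := fun p => ∑ l, (β' l p.1 - β l p.1) * p.2 l with hD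
  have hDm : Measurable D := by
    refine Finset.measurable_fun_sum _ fun l _ => Measurable.mul ?_ (by fun_prop)
    exact ((hβ' l).comp measurable_fst).sub ((hβ l).comp measurable_fst)
  -- Replacing `β` by `β'` at a given design is the same as translating the noise by `w`.
  set w : (Fin n → ℝ × (Fin r → ℝ)) → EuclideanSpace ℝ (Fin n) :=
    fun z => WithLp.toLp 2 fun i => D (z i) / σ with hw
  have hshift : ∀ z ε, Φ β' (z, ε) = Φ β (z, ε + w z) := fun z ε => by
    ext1 i
    simp only [hΦ, hw, hD, PiLp.add_apply, Prod.mk.injEq, true_and, sub_mul,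
      Finset.sum_sub_distrib]
    field_simp
    ring
  set Q := Measure.pi fun _ : Fin n => ν
  have hinner : ∀ z, s * ENNReal.ofReal (3 / 4) ≤
      ∫⁻ ε, G₀ (Φ β (z, ε)) ∂multivariateGaussian 0 S +
      ∫⁻ ε, G₁ (Φ β' (z, ε)) ∂multivariateGaussian 0 S +
        s * ENNReal.ofReal (3 / 2 * (‖w z‖ ^ 2 / c)) := fun z => by
    simp_rw [hshift z]
    exact multivariateGaussian_two_point hS hc hev
      (h₀.comp (hm.comp measurable_prodMk_left)) (h₁.comp (hm.comp measurable_prodMk_left))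
      (fun ε => hs _) (w z)
  -- The threshold `c σ² / 6` makes the error `1/4`, leaving `3/4 - 1/4 = 1/2`.
  have hnorm : ∫⁻ z, ENNReal.ofReal (3 / 2 * (‖w z‖ ^ 2 / c)) ∂Q ≤ ENNReal.ofReal (1 / 4) := by
    have hK : 0 ≤ 3 / (2 * c * σ ^ 2) := by positivity
    have h₂ : ∀ z, ENNReal.ofReal (3 / 2 * (‖w z‖ ^ 2 / c)) =
        ENNReal.ofReal (3 / (2 * c * σ ^ 2)) * ∑ i, ENNReal.ofReal (D (z i) ^ 2) := fun z => by
      rw [← ENNReal.ofReal_sum_of_nonneg fun i _ => sq_nonneg _, ← ENNReal.ofReal_mul hK,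
        EuclideanSpace.real_norm_sq_eq]
      congr 1
      simp only [hw, div_pow, ← Finset.sum_div]
      field_simp
    have h₃ : ∀ i : Fin n, ∫⁻ z, ENNReal.ofReal (D (z i) ^ 2) ∂Q =
        ∫⁻ p, ENNReal.ofReal (D p ^ 2) ∂ν := fun i =>
      (measurePreserving_eval (fun _ : Fin n => ν) i).lintegral_comp
        (f := fun p => ENNReal.ofReal (D p ^ 2)) (by fun_prop)
    simp_rw [h₂]
    rw [lintegral_const_mul _ (by fun_prop), lintegral_finsetSum _ (by fun_prop)]
    simp_rw [h₃]
    rw [Finset.sum_const, Finset.card_univ, Fintype.card_fin, nsmul_eq_mul]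
    calc _ ≤ ENNReal.ofReal (3 / (2 * c * σ ^ 2)) * ENNReal.ofReal (c * σ ^ 2 / 6) := by gcongr
      _ = ENNReal.ofReal (1 / 4) := by
        rw [← ENNReal.ofReal_mul hK]
        congr 1
        field_simp
        norm_num
  have hwm : Measurable w := by
    refine (WithLp.measurable_toLp 2 _).comp (measurable_pi_lambda _ fun i => ?_)
    exact (hDm.comp (measurable_pi_apply i)).div_const σ
  have e₀ : ∫⁻ d, G₀ d ∂dataLaw n ν S σ β =
      ∫⁻ z, ∫⁻ ε, G₀ (Φ β (z, ε)) ∂multivariateGaussian 0 S ∂Q := by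
    rw [dataLaw, lintegral_map h₀ hm]
    exact lintegral_prod _ (h₀.comp hm).aemeasurable
  have e₁ : ∫⁻ d, G₁ d ∂dataLaw n ν S σ β' =
      ∫⁻ z, ∫⁻ ε, G₁ (Φ β' (z, ε)) ∂multivariateGaussian 0 S ∂Q := by
    rw [dataLaw, lintegral_map h₁ hm']
    exact lintegral_prod _ (h₁.comp hm').aemeasurable
  have htot : s * ENNReal.ofReal (3 / 4) ≤
      ∫⁻ d, G₀ d ∂dataLaw n ν S σ β + ∫⁻ d, G₁ d ∂dataLaw n ν S σ β' +
        s * ENNReal.ofReal (1 / 4) := by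
    calc s * ENNReal.ofReal (3 / 4) = ∫⁻ _, s * ENNReal.ofReal (3 / 4) ∂Q := by simp
      _ ≤ _ := lintegral_mono hinner
      _ = ∫⁻ d, G₀ d ∂dataLaw n ν S σ β + ∫⁻ d, G₁ d ∂dataLaw n ν S σ β' +
          s * ∫⁻ z, ENNReal.ofReal (3 / 2 * (‖w z‖ ^ 2 / c)) ∂Q := by
        have hm₀ : Measurable fun z => ∫⁻ ε, G₀ (Φ β (z, ε)) ∂multivariateGaussian 0 S :=
          (h₀.comp hm).lintegral_prod_right'
        rw [lintegral_add_right _ (by fun_prop), e₀, e₁, lintegral_add_left hm₀,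
          lintegral_const_mul _ (by fun_prop)]
      _ ≤ _ := by gcongr
  have hsplit : s * ENNReal.ofReal (3 / 4) =
      s * ENNReal.ofReal (1 / 2) + s * ENNReal.ofReal (1 / 4) := by
    rw [← mul_add, ← ENNReal.ofReal_add (by norm_num) (by norm_num)]
    norm_num
  rw [hsplit] at htot
  exact (ENNReal.add_le_add_iff_right (ENNReal.mul_ne_top hs_top ENNReal.ofReal_ne_top)).1 htot

/-! ### Assouad's lemma -/

lemma sum_flip_coord {κ M : Type*} [Fintype κ] [DecidableEq κ] [AddCommMonoid M]
    (g : (κ → Bool) → M) (k : κ) :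
    ∑ ω, g (Function.update ω k (!ω k)) = ∑ ω, g ω := by
  refine Fintype.sum_bijective (fun ω : κ → Bool => Function.update ω k (!ω k)) ?_ _ _
    fun ω => rfl
  refine Function.Involutive.bijective fun ω => ?_
  ext i
  by_cases h : i = k
  · subst h; simp
  · simp [h]

/-- Sum over all vertices of the cube: for each `k` the flip permutes the vertices, so the two-point
bounds add up to twice the total of the `k`-th losses. Summing over `k` and bounding each vertex by
`V` concludes. -/
lemma assouad {κ D : Type*} [Fintype κ] [DecidableEq κ] [MeasurableSpace D]
    (P : (κ → Bool) → Measure D) (F : (κ → Bool) → D → ℝ≥0∞) (G : κ → Bool → D → ℝ≥0∞)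
    (hG : ∀ k b, Measurable (G k b)) (hGF : ∀ ω d, ∑ k, G k (ω k) d ≤ F ω d) {a V : ℝ≥0∞}
    (ha : ∀ ω k, a ≤ ∫⁻ d, G k (ω k) d ∂P ω +
      ∫⁻ d, G k (!ω k) d ∂P (Function.update ω k (!ω k)))
    (hV : ∀ ω, ∫⁻ d, F ω d ∂P ω ≤ V) :
    (Fintype.card κ : ℝ≥0∞) * a ≤ 2 * V := by
  set N : ℝ≥0∞ := (Fintype.card (κ → Bool) : ℝ≥0∞)
  have hN0 : N ≠ 0 := by simp [N]
  have hNt : N ≠ ∞ := ENNReal.natCast_ne_top _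
  set I : (κ → Bool) → κ → ℝ≥0∞ := fun ω k => ∫⁻ d, G k (ω k) d ∂P ω
  have h₁ : ∀ ω, ∑ k, I ω k ≤ V := fun ω => by
    rw [← lintegral_finsetSum _ fun k _ => hG k (ω k)]
    exact (lintegral_mono fun d => hGF ω d).trans (hV ω)
  have h₂ : ∀ k, N * a ≤ 2 * ∑ ω, I ω k := fun k => by
    calc N * a = ∑ _ω : κ → Bool, a := by simp [N]
      _ ≤ ∑ ω, (I ω k + I (Function.update ω k (!ω k)) k) :=
          Finset.sum_le_sum fun ω _ => by simpa [I] using ha ω k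
      _ = 2 * ∑ ω, I ω k := by
          rw [Finset.sum_add_distrib, sum_flip_coord (fun ω => I ω k) k, two_mul]
  have h₃ : N * (Fintype.card κ * a) ≤ N * (2 * V) := by
    calc N * (Fintype.card κ * a) = ∑ _k : κ, N * a := by simp; ring
      _ ≤ ∑ k, 2 * ∑ ω, I ω k := Finset.sum_le_sum fun k _ => h₂ k
      _ = 2 * ∑ ω, ∑ k, I ω k := by rw [← Finset.mul_sum, Finset.sum_comm]
      _ ≤ 2 * ∑ _ω : κ → Bool, V := by gcongr with ω; exact h₁ ω
      _ = N * (2 * V) := by simp [N]; ring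
  exact (ENNReal.mul_le_mul_iff_right hN0 hNt).1 h₃

/-! ### Perturbations along an orthonormal system -/

lemma integral_sub_mul_of_memLp {m : Measure ℝ} {f g e : ℝ → ℝ} (hf : MemLp f 2 m)
    (hg : MemLp g 2 m) (he : MemLp e 2 m) :
    ∫ t, (f t - g t) * e t ∂m = (∫ t, f t * e t ∂m) - ∫ t, g t * e t ∂m := by
  have i₁ : Integrable (fun t => f t * e t) m := hf.integrable_mul he
  have i₂ : Integrable (fun t => g t * e t) m := hg.integrable_mul he
  simp only [sub_mul]
  rw [integral_sub i₁ i₂]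

/-- Bessel's inequality for vectors of squared norm `2`, from the nonnegativity of the squared
distance from `q` to its projection `p`. -/
lemma bessel_two {ι : Type*} [Fintype ι] [DecidableEq ι] {m : Measure ℝ} {ψ : ι → ℝ → ℝ}
    (hψ : ∀ k, MemLp (ψ k) 2 m) (hort : ∀ j k, ∫ t, ψ j t * ψ k t ∂m = if j = k then 2 else 0)
    {q : ℝ → ℝ} (hq : MemLp q 2 m) :
    ∑ k, (∫ t, q t * ψ k t ∂m) ^ 2 / 2 ≤ ∫ t, q t ^ 2 ∂m := by
  set c : ι → ℝ := fun k => (∫ t, q t * ψ k t ∂m) / 2 with hc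
  set p : ℝ → ℝ := fun t => ∑ k, c k * ψ k t with hp
  have hpm : MemLp p 2 m := memLp_finsetSum _ fun k _ => (hψ k).const_mul (c k)
  have hqp : ∫ t, q t * p t ∂m = 2 * ∑ k, c k ^ 2 := by
    simp only [hp, Finset.mul_sum]
    rw [integral_finsetSum]
    · refine Finset.sum_congr rfl fun k _ => ?_
      simp_rw [mul_left_comm _ (c k)]
      rw [integral_const_mul, show ∫ t, q t * ψ k t ∂m = 2 * c k by simp only [hc]; ring]
      ring
    · intro k _
      exact hq.integrable_mul ((hψ k).const_mul (c k))
  have hpp : ∫ t, p t * p t ∂m = 2 * ∑ k, c k ^ 2 := by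
    have : ∀ k, ∫ t, p t * ψ k t ∂m = 2 * c k := fun k => by
      simp only [hp, Finset.sum_mul, mul_assoc]
      rw [integral_finsetSum]
      · simp_rw [integral_const_mul, hort]
        simp [mul_comm]
      · intro j _
        exact ((hψ j).integrable_mul (hψ k)).const_mul (c j)
    conv_lhs => enter [2, t]; rw [hp]; simp only [Finset.mul_sum]
    rw [integral_finsetSum]
    · rw [Finset.mul_sum]
      refine Finset.sum_congr rfl fun k _ => ?_
      simp_rw [mul_left_comm _ (c k)]
      rw [integral_const_mul, this k]
      ring
    · intro k _
      exact hpm.integrable_mul ((hψ k).const_mul (c k))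
  have h0 : 0 ≤ ∫ t, (q t - p t) ^ 2 ∂m := integral_nonneg fun t => sq_nonneg _
  have hexp : ∫ t, (q t - p t) ^ 2 ∂m =
      ∫ t, q t ^ 2 ∂m - 2 * ∫ t, q t * p t ∂m + ∫ t, p t * p t ∂m := by
    have i₁ : Integrable (fun t => q t ^ 2) m := hq.integrable_sq
    have i₂ : Integrable (fun t => 2 * (q t * p t)) m := (hq.integrable_mul hpm).const_mul 2
    have i₃ : Integrable (fun t => p t * p t) m := hpm.integrable_mul hpm
    have i₄ : Integrable (fun t => q t ^ 2 - 2 * (q t * p t)) m := i₁.sub i₂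
    rw [← integral_const_mul, ← integral_sub i₁ i₂, ← integral_add i₄ i₃]
    exact integral_congr_ae (ae_of_all _ fun t => by ring)
  rw [hexp, hqp, hpp] at h0
  have : ∑ k, (∫ t, q t * ψ k t ∂m) ^ 2 / 2 = 2 * ∑ k, c k ^ 2 := by
    rw [Finset.mul_sum]
    exact Finset.sum_congr rfl fun k _ => by simp only [hc]; ring
  linarith

/-- The perturbation `δ ∑_k ω_k ψ_k`. -/
def perturb {ι : Type*} [Fintype ι] (ψ : ι → ℝ → ℝ) (δ : ℝ) (ω : ι → Bool) (t : ℝ) : ℝ :=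
  ∑ k, (if ω k then δ else 0) * ψ k t

lemma measurable_perturb {ι : Type*} [Fintype ι] {ψ : ι → ℝ → ℝ} (hψ : ∀ k, Measurable (ψ k))
    (δ : ℝ) (ω : ι → Bool) : Measurable (perturb ψ δ ω) :=
  Finset.measurable_fun_sum _ fun k _ => (hψ k).const_mul _

lemma memLp_perturb {ι : Type*} [Fintype ι] {m : Measure ℝ} {ψ : ι → ℝ → ℝ}
    (hψ : ∀ k, MemLp (ψ k) 2 m) (δ : ℝ) (ω : ι → Bool) : MemLp (perturb ψ δ ω) 2 m :=
  memLp_finsetSum _ fun k _ => (hψ k).const_mul _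

lemma integral_perturb_mul {ι : Type*} [Fintype ι] {m : Measure ℝ} {ψ : ι → ℝ → ℝ}
    (hψ : ∀ k, MemLp (ψ k) 2 m) (δ : ℝ) (ω : ι → Bool) {e : ℝ → ℝ} (he : MemLp e 2 m) :
    ∫ t, perturb ψ δ ω t * e t ∂m = ∑ k, (if ω k then δ else 0) * ∫ t, ψ k t * e t ∂m := by
  simp only [perturb, Finset.sum_mul, mul_assoc]
  rw [integral_finsetSum]
  · simp_rw [integral_const_mul]
  · intro k _
    exact ((hψ k).integrable_mul he).const_mul _

lemma perturb_flip_sub {ι : Type*} [Fintype ι] [DecidableEq ι] (ψ : ι → ℝ → ℝ) (δ : ℝ)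
    (ω : ι → Bool) (k : ι) (t : ℝ) :
    (perturb ψ δ (Function.update ω k (!ω k)) t - perturb ψ δ ω t) ^ 2 = (δ * ψ k t) ^ 2 := by
  simp only [perturb]
  rw [← Finset.sum_sub_distrib, Finset.sum_eq_single k]
  · cases ω k <;> simp
  · intro j _ hj
    simp [hj]
  · simp

/-- Bessel decouples the loss into terms that see `ω` only through one coordinate, as Assouad's
argument requires. -/
lemma sum_le_lintegral_sub_perturb {ι : Type*} [Fintype ι] [DecidableEq ι] {m : Measure ℝ}
    {ψ : ι → ℝ → ℝ} (hψ : ∀ k, MemLp (ψ k) 2 m)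
    (hort : ∀ j k, ∫ t, ψ j t * ψ k t ∂m = if j = k then 2 else 0) (δ : ℝ) (ω : ι → Bool)
    {g : ℝ → ℝ} (hg : Measurable g) (hpm : Measurable (perturb ψ δ ω)) :
    ∑ k, ENNReal.ofReal (((∫ t, g t * ψ k t ∂m) - (if ω k then 2 * δ else 0)) ^ 2 / 2) ≤
      ∫⁻ t, ENNReal.ofReal ((g t - perturb ψ δ ω t) ^ 2) ∂m := by
  have hp := memLp_perturb hψ δ ω
  by_cases hint : Integrable (fun t => (g t - perturb ψ δ ω t) ^ 2) m
  · have hq : MemLp (fun t => g t - perturb ψ δ ω t) 2 m :=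
      (memLp_two_iff_integrable_sq (hg.sub hpm).aestronglyMeasurable).2 hint
    have hgm : MemLp g 2 m := (memLp_congr_ae (ae_of_all _ fun t => by simp)).1 (hq.add hp)
    have h₁ : ∀ k, ∫ t, (g t - perturb ψ δ ω t) * ψ k t ∂m =
        (∫ t, g t * ψ k t ∂m) - (if ω k then 2 * δ else 0) := fun k => by
      rw [integral_sub_mul_of_memLp hgm hp (hψ k), integral_perturb_mul hψ δ ω (hψ k)]
      simp only [hort]
      simp [mul_comm]
    rw [← ofReal_integral_eq_lintegral_ofReal hint (ae_of_all _ fun t => sq_nonneg _),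
      ← ENNReal.ofReal_sum_of_nonneg fun k _ => by positivity]
    refine ENNReal.ofReal_le_ofReal ?_
    simp_rw [← h₁]
    exact bessel_two hψ hort hq
  -- Without square integrability the coefficients of `g` may be default values, but the loss is
  -- infinite.
  · have : ∫⁻ t, ENNReal.ofReal ((g t - perturb ψ δ ω t) ^ 2) ∂m = ∞ := by
      by_contra hne
      refine hint ⟨((hg.sub hpm).pow_const 2).aestronglyMeasurable, ?_⟩
      rw [hasFiniteIntegral_iff_ofReal (ae_of_all _ fun t => sq_nonneg _)]
      exact lt_top_iff_ne_top.2 hne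
    rw [this]
    exact le_top

/-- The difference `e_{2(M+k)+1} - e_{2(M+k)}` of consecutive members of a system. -/
def pairDiff (e : ℕ → ℝ → ℝ) (M : ℕ) (k : Fin M) (t : ℝ) : ℝ :=
  e (2 * (M + k) + 1) t - e (2 * (M + k)) t

lemma memLp_pairDiff {m : Measure ℝ} {e : ℕ → ℝ → ℝ} (he : ∀ k, MemLp (e k) 2 m) (M : ℕ) (k : Fin M) : MemLp (pairDiff e M k) 2 m := (he _).sub (he _)

lemma integral_pairDiff_mul {m : Measure ℝ} {e : ℕ → ℝ → ℝ} (he : ∀ k, MemLp (e k) 2 m)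
    (hon : ∀ j k, ∫ t, e j t * e k t ∂m = if j = k then 1 else 0)
    (M : ℕ) (k : Fin M) (j : ℕ) :
    ∫ t, pairDiff e M k t * e j t ∂m =
      (if 2 * (M + k) + 1 = j then 1 else 0) - if 2 * (M + k) = j then 1 else 0 := by
  simp only [pairDiff]
  rw [integral_sub_mul_of_memLp (he _) (he _) (he _), hon, hon]

lemma integral_pairDiff_mul_pairDiff {m : Measure ℝ} {e : ℕ → ℝ → ℝ} (he : ∀ k, MemLp (e k) 2 m)
    (hon : ∀ j k, ∫ t, e j t * e k t ∂m = if j = k then 1 else 0)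
    (M : ℕ) (j k : Fin M) :
    ∫ t, pairDiff e M j t * pairDiff e M k t ∂m = if j = k then 2 else 0 := by
  have : ∀ t, pairDiff e M j t * pairDiff e M k t =
      (e (2 * (M + k) + 1) t - e (2 * (M + k)) t) * pairDiff e M j t := fun t => mul_comm _ _
  simp_rw [this]
  rw [integral_sub_mul_of_memLp (he _) (he _) (memLp_pairDiff he M j)]
  simp_rw [mul_comm (e _ _) (pairDiff e M j _), integral_pairDiff_mul he hon]
  by_cases h : j = k
  · subst h; norm_num
  · have h' : (j : ℕ) ≠ k := fun hh => h (Fin.ext hh)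
    have h₁ : 2 * (M + (j : ℕ)) + 1 ≠ 2 * (M + k) + 1 := by omega
    have h₂ : 2 * (M + (j : ℕ)) ≠ 2 * (M + k) + 1 := by omega
    have h₃ : 2 * (M + (j : ℕ)) + 1 ≠ 2 * (M + k) := by omega
    have h₄ : 2 * (M + (j : ℕ)) ≠ 2 * (M + k) := by omega
    rw [if_neg h₁, if_neg h₂, if_neg h₃, if_neg h₄, if_neg h]
    norm_num

/-- The `M` pairs tile `[2M, 4M)`, so there are `2M` possibly nonzero coefficients, each `0` or
`±δ`, with weights at most `(4M)^{2γ}`. -/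
lemma perturb_pairDiff_mem_sobolevBall {m : Measure ℝ} {e : ℕ → ℝ → ℝ} (he : ∀ k, MemLp (e k) 2 m)
    (hon : ∀ j k, ∫ t, e j t * e k t ∂m = if j = k then 1 else 0)
    (hem : ∀ k, Measurable (e k)) {M : ℕ} {γ A δ : ℝ}
    (hγ : 0 < γ) (hδ : 2 * M * ((4 * M : ℝ) ^ (2 * γ) * δ ^ 2) ≤ A ^ 2) (ω : Fin M → Bool) :
    perturb (pairDiff e M) δ ω ∈ sobolevBall m e γ A := by
  refine ⟨measurable_perturb (fun k => (hem _).sub (hem _)) δ ω,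
    memLp_perturb (memLp_pairDiff he M) δ ω, ?_⟩
  have hcoef : ∀ j, ∫ t, perturb (pairDiff e M) δ ω t * e j t ∂m =
      ∑ k, (if ω k then δ else 0) *
        ((if 2 * (M + (k : ℕ)) + 1 = j then 1 else 0) - if 2 * (M + (k : ℕ)) = j then 1 else 0) :=
    fun j => by
      rw [integral_perturb_mul (memLp_pairDiff he M) δ ω (he j)]
      simp_rw [integral_pairDiff_mul he hon]
  have hzero : ∀ j, j ∉ Finset.Ico (2 * M) (4 * M) →
      ∫ t, perturb (pairDiff e M) δ ω t * e j t ∂m = 0 := fun j hj => by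
    rw [hcoef]
    refine Finset.sum_eq_zero fun k _ => ?_
    rw [Finset.mem_Ico] at hj
    have h₁ : 2 * (M + (k : ℕ)) + 1 ≠ j := by omega
    have h₂ : 2 * (M + (k : ℕ)) ≠ j := by omega
    rw [if_neg h₁, if_neg h₂]
    simp
  have hle : ∀ j ∈ Finset.Ico (2 * M) (4 * M),
      (∫ t, perturb (pairDiff e M) δ ω t * e j t ∂m) ^ 2 ≤ δ ^ 2 := fun j hj => by
    rw [Finset.mem_Ico] at hj
    -- The unique pair containing the index `j`.
    rw [hcoef, Finset.sum_eq_single (⟨j / 2 - M, by omega⟩ : Fin M)]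
    · have h₀ : 0 ≤ δ ^ 2 := sq_nonneg δ
      split_ifs <;> first | omega | simp [h₀]
    · intro k _ hk
      have : (k : ℕ) ≠ j / 2 - M := fun hh => hk (Fin.ext hh)
      have h₁ : 2 * (M + (k : ℕ)) + 1 ≠ j := by omega
      have h₂ : 2 * (M + (k : ℕ)) ≠ j := by omega
      rw [if_neg h₁, if_neg h₂]
      simp
    · simp
  rw [tsum_eq_sum (s := Finset.Ico (2 * M) (4 * M)) fun j hj => by
    rw [hzero j hj]; simp]
  calc _ ≤ ∑ _j ∈ Finset.Ico (2 * M) (4 * M),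
        ENNReal.ofReal ((4 * M : ℝ) ^ (2 * γ) * δ ^ 2) := by
        refine Finset.sum_le_sum fun j hj => ENNReal.ofReal_le_ofReal ?_
        refine mul_le_mul (Real.rpow_le_rpow (by positivity) ?_ (by positivity)) (hle j hj)
          (sq_nonneg _) (by positivity)
        rw [Finset.mem_Ico] at hj
        exact_mod_cast (by omega : max j 1 ≤ 4 * M)
    _ = ENNReal.ofReal (2 * M * ((4 * M : ℝ) ^ (2 * γ) * δ ^ 2)) := by
        rw [Finset.sum_const, Nat.card_Ico, nsmul_eq_mul,
          show 4 * M - 2 * M = 2 * M by omega, ← ENNReal.ofReal_natCast,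
          ← ENNReal.ofReal_mul (by positivity)]
        push_cast
        rfl
    _ ≤ _ := ENNReal.ofReal_le_ofReal hδ

/-! ### Lower bounds for the minimax risk -/

lemma zero_mem_sobolevBall (m : Measure ℝ) (e : ℕ → ℝ → ℝ) (γ A : ℝ) :
    (fun _ => (0 : ℝ)) ∈ sobolevBall m e γ A :=
  ⟨measurable_const, MemLp.zero, by simp⟩

lemma ofReal_le_minimaxRisk {r n : ℕ} {ν : Measure (ℝ × (Fin r → ℝ))} [IsProbabilityMeasure ν]
    {R : ℝ} (hR : ∀ᵐ p ∂ν, ∀ l, |p.2 l| ≤ R) {m : Measure ℝ} [SFinite m] {e : ℕ → ℝ → ℝ}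
    (hem : ∀ k, Measurable (e k)) (he : ∀ k, MemLp (e k) 2 m)
    (hon : ∀ j k, ∫ t, e j t * e k t ∂m = if j = k then 1 else 0)
    (hτ : ∀ k, ∫⁻ t, ENNReal.ofReal ((e (k + 1) t - e k t) ^ 2) ∂ν.map Prod.fst ≤ 2)
    {S : Matrix (Fin n) (Fin n) ℝ} (hS : S.PosSemidef) {c : ℝ} (hc : 0 < c)
    (hev : ∀ x : ℝ, Module.End.HasEigenvalue (Matrix.toLin' S) x → c ≤ x)
    {σ : ℝ} (hσ : 0 < σ) {γ A : Fin r → ℝ} (l : Fin r) (hγ : 0 < γ l) {M : ℕ} {δ : ℝ}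
    (hδA : 2 * M * ((4 * M : ℝ) ^ (2 * γ l) * δ ^ 2) ≤ A l ^ 2)
    (hδσ : n * (2 * (δ ^ 2 * R ^ 2)) ≤ c * σ ^ 2 / 6) :
    ENNReal.ofReal (M * δ ^ 2 / 4) ≤
      minimaxRisk m n ν S σ {β | ∀ l, β l ∈ sobolevBall m e (γ l) (A l)} := by
  set ψ := pairDiff e M with hψ
  have hψm : ∀ k, Measurable (ψ k) := fun k => (hem _).sub (hem _)
  have hψ2 : ∀ k, MemLp (ψ k) 2 m := memLp_pairDiff he M
  set b : (Fin M → Bool) → Fin r → ℝ → ℝ := fun ω => Pi.single l (perturb ψ δ ω) with hb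
  have hb0 : ∀ ω l', l' ≠ l → b ω l' = fun _ => 0 := fun ω l' h => Pi.single_eq_of_ne h _
  have hbm : ∀ ω l', Measurable (b ω l') := fun ω l' => by
    by_cases h : l' = l
    · subst h
      simpa [hb] using measurable_perturb hψm δ ω
    · rw [hb0 ω l' h]
      exact measurable_const
  have hbΘ : ∀ ω l', b ω l' ∈ sobolevBall m e (γ l') (A l') := fun ω l' => by
    by_cases h : l' = l
    · subst h
      simpa [hb] using perturb_pairDiff_mem_sobolevBall he hon hem hγ hδA ω
    · rw [hb0 ω l' h]
      exact zero_mem_sobolevBall _ _ _ _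
  refine le_iInf₂ fun f hf => ?_
  set V := ⨆ β ∈ {β : Fin r → ℝ → ℝ | ∀ l, β l ∈ sobolevBall m e (γ l) (A l)},
    risk m n ν S σ f β
  set a : Fin M → Data r n → ℝ := fun k d => ∫ t, f d l t * ψ k t ∂m with ha
  have ham : ∀ k, Measurable (a k) := fun k => by
    have : Measurable fun q : Data r n × ℝ => f q.1 l q.2 * ψ k q.2 :=
      (hf l).mul ((hψm k).comp measurable_snd)
    exact (this.stronglyMeasurable.integral_prod_right' (ν := m)).measurable
  set G : Fin M → Bool → Data r n → ℝ≥0∞ :=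
    fun k i d => ENNReal.ofReal ((a k d - if i then 2 * δ else 0) ^ 2 / 2) with hG
  have hGm : ∀ k i, Measurable (G k i) := fun k i =>
    (((ham k).sub_const _).pow_const 2).div_const 2 |>.ennreal_ofReal
  -- This is `(a² + (a - 2δ)²)/2 = (a - δ)² + δ²`.
  have hsum : ∀ k i d, ENNReal.ofReal (δ ^ 2) ≤ G k i d + G k (!i) d := fun k i d => by
    rw [hG, ← ENNReal.ofReal_add (by positivity) (by positivity)]
    refine ENNReal.ofReal_le_ofReal ?_
    cases i <;> simp <;> nlinarith [sq_nonneg (a k d - δ)]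
  have hmain := assouad (fun ω => dataLaw n ν S σ (b ω))
    (fun ω d => ∑ l', ∫⁻ t, ENNReal.ofReal ((f d l' t - b ω l' t) ^ 2) ∂m) G hGm
    (fun ω d => ?_) (a := ENNReal.ofReal (δ ^ 2) * ENNReal.ofReal (1 / 2)) (V := V)
    (fun ω k => ?_) (fun ω => ?_)
  · rw [Fintype.card_fin, ← ENNReal.ofReal_mul (sq_nonneg δ), ← ENNReal.ofReal_natCast,
      ← ENNReal.ofReal_mul (by positivity)] at hmain
    have h2 : ENNReal.ofReal (M * (δ ^ 2 * (1 / 2))) = 2 * ENNReal.ofReal (M * δ ^ 2 / 4) := by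
      rw [← ENNReal.ofReal_ofNat 2, ← ENNReal.ofReal_mul (by norm_num)]
      congr 1
      ring
    rw [h2] at hmain
    exact (ENNReal.mul_le_mul_iff_right (by norm_num) (by norm_num)).1 hmain
  · have hfm : Measurable (f d l) := (hf l).comp measurable_prodMk_left
    refine (sum_le_lintegral_sub_perturb hψ2 (integral_pairDiff_mul_pairDiff he hon M) δ ω hfm
      (measurable_perturb hψm δ ω)).trans ?_
    have := Finset.single_le_sum
      (f := fun l' => ∫⁻ t, ENNReal.ofReal ((f d l' t - b ω l' t) ^ 2) ∂m)
      (fun i _ => zero_le) (Finset.mem_univ l)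
    simpa [hb] using this
  · refine dataLaw_two_point hS hc hev hσ (hbm _) (hbm _) (hGm _ _) (hGm _ _)
      ENNReal.ofReal_ne_top (hsum k (ω k)) ?_
    have hD : ∀ p : ℝ × (Fin r → ℝ),
        (∑ l', (b (Function.update ω k (!ω k)) l' p.1 - b ω l' p.1) * p.2 l') ^ 2 =
          (δ * ψ k p.1) ^ 2 * p.2 l ^ 2 := fun p => by
      rw [Finset.sum_eq_single l]
      · simp only [hb, Pi.single_eq_same]
        rw [mul_pow, perturb_flip_sub]
      · intro l' _ hl'
        simp [hb, Pi.single_eq_of_ne hl']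
      · simp
    simp_rw [hD]
    -- Bounding the covariate by `R` removes its dependence on the time, leaving an integral against
    -- the time law alone.
    have hint : ∫⁻ p, ENNReal.ofReal ((δ * ψ k p.1) ^ 2 * p.2 l ^ 2) ∂ν ≤
        ENNReal.ofReal (2 * (δ ^ 2 * R ^ 2)) := by
      calc _ ≤ ∫⁻ p, ENNReal.ofReal (δ ^ 2 * R ^ 2) * ENNReal.ofReal (ψ k p.1 ^ 2) ∂ν := by
            refine lintegral_mono_ae ?_
            filter_upwards [hR] with p hp
            rw [← ENNReal.ofReal_mul (by positivity)]
            refine ENNReal.ofReal_le_ofReal ?_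
            have : p.2 l ^ 2 ≤ R ^ 2 := by
              rw [← sq_abs (p.2 l)]
              exact pow_le_pow_left₀ (abs_nonneg _) (hp l) 2
            calc (δ * ψ k p.1) ^ 2 * p.2 l ^ 2 ≤ (δ * ψ k p.1) ^ 2 * R ^ 2 := by gcongr
              _ = _ := by ring
        _ = ENNReal.ofReal (δ ^ 2 * R ^ 2) *
            ∫⁻ t, ENNReal.ofReal (ψ k t ^ 2) ∂ν.map Prod.fst := by
            have hm2 : Measurable fun t => ENNReal.ofReal (ψ k t ^ 2) :=
              ((hψm k).pow_const 2).ennreal_ofReal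
            rw [lintegral_map hm2 measurable_fst]
            exact lintegral_const_mul _ (hm2.comp measurable_fst)
        _ ≤ ENNReal.ofReal (δ ^ 2 * R ^ 2) * 2 := by gcongr; exact hτ _
        _ = _ := by
            rw [← ENNReal.ofReal_ofNat 2, ← ENNReal.ofReal_mul (by positivity), mul_comm]
    calc _ ≤ (n : ℝ≥0∞) * ENNReal.ofReal (2 * (δ ^ 2 * R ^ 2)) := by gcongr
      _ = ENNReal.ofReal (n * (2 * (δ ^ 2 * R ^ 2))) := by
          rw [← ENNReal.ofReal_natCast, ← ENNReal.ofReal_mul (by positivity)]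
      _ ≤ _ := ENNReal.ofReal_le_ofReal hδσ
  · exact le_iSup₂_of_le (b ω) (hbΘ ω) le_rfl

/-- Choice of the resolution level `M` and of the amplitude `δ` of the perturbations. -/
lemma exists_level_amplitude {γ κ A X : ℝ} (hγ : 0 < γ) (hκ : 0 < κ) (hX : 0 < X) (hκX : κ ≤ X) :
    ∃ (M : ℕ) (δ : ℝ), 2 * M * ((4 * M : ℝ) ^ (2 * γ) * δ ^ 2) ≤ A ^ 2 ∧
      δ ^ 2 ≤ A ^ 2 * κ / X ∧
      (8 : ℝ) ^ (-(2 * γ)) / 16 * κ ^ (2 * γ / (2 * γ + 1)) *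
        (A ^ 2 * (1 / X) ^ (2 * γ / (2 * γ + 1))) ≤ M * δ ^ 2 / 4 := by
  have hg : 0 < 2 * γ + 1 := by positivity
  -- With `M` of order `T` and `δ² = A² (4M)^{-(2γ+1)}`, the ball constraint holds for every such
  -- `M`, and `M ≥ T` is what the indistinguishability bound `δ² ≤ A² κ / X` needs. The assumption
  -- `κ ≤ X` gives `T ≥ 1`, so rounding up costs at most a factor `2`.
  set T : ℝ := (X / κ) ^ (1 / (2 * γ + 1)) with hT
  have hT1 : 1 ≤ T := Real.one_le_rpow ((one_le_div hκ).2 hκX) (by positivity)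
  have hT0 : 0 < T := by linarith
  set M : ℕ := ⌈T⌉₊ with hM
  have hTM : T ≤ M := Nat.le_ceil T
  have hMT : (4 * M : ℝ) ≤ 8 * T := by
    have := Nat.ceil_lt_add_one hT0.le
    linarith
  have hM0 : (0 : ℝ) < M := by linarith
  have hTpow : T ^ (2 * γ + 1) = X / κ := by
    rw [hT, ← Real.rpow_mul (by positivity), one_div_mul_cancel hg.ne', Real.rpow_one]
  set E : ℝ := (4 * M : ℝ) ^ (-(2 * γ + 1)) with hE
  have hE0 : 0 < E := by positivity
  have hδ : (A * Real.sqrt E) ^ 2 = A ^ 2 * E := by rw [mul_pow, Real.sq_sqrt hE0.le]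
  have hMul : 4 * M * E = (4 * M : ℝ) ^ (-(2 * γ)) := by
    rw [hE, show -(2 * γ) = 1 + -(2 * γ + 1) by ring, Real.rpow_add (by positivity), Real.rpow_one]
  refine ⟨M, A * Real.sqrt E, ?_, ?_, ?_⟩
  · have h₁ : (4 * M : ℝ) ^ (2 * γ) * (4 * M * E) = 1 := by
      rw [hMul, ← Real.rpow_add (by positivity)]
      simp
    rw [hδ, show 2 * (M : ℝ) * ((4 * M : ℝ) ^ (2 * γ) * (A ^ 2 * E)) =
      A ^ 2 / 2 * ((4 * M : ℝ) ^ (2 * γ) * (4 * M * E)) by ring, h₁]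
    nlinarith [sq_nonneg A]
  · rw [hδ, mul_div_assoc]
    refine mul_le_mul_of_nonneg_left ?_ (sq_nonneg A)
    rw [show κ / X = T ^ (-(2 * γ + 1)) by rw [Real.rpow_neg hT0.le, hTpow, inv_div]]
    exact Real.rpow_le_rpow_of_nonpos hT0 (by linarith) (by linarith)
  · rw [hδ, show (M : ℝ) * (A ^ 2 * E) / 4 = A ^ 2 / 16 * (4 * M * E) by ring, hMul]
    have h₁ : (8 * T) ^ (-(2 * γ)) ≤ (4 * M : ℝ) ^ (-(2 * γ)) :=
      Real.rpow_le_rpow_of_nonpos (by positivity) hMT (by linarith)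
    have h₂ : T ^ (-(2 * γ)) = κ ^ (2 * γ / (2 * γ + 1)) * (1 / X) ^ (2 * γ / (2 * γ + 1)) := by
      rw [← Real.mul_rpow hκ.le (by positivity), hT, ← Real.rpow_mul (by positivity),
        show κ * (1 / X) = (X / κ)⁻¹ by rw [inv_div]; ring, Real.inv_rpow (by positivity),
        ← Real.rpow_neg (by positivity)]
      congr 1
      field_simp
    rw [Real.mul_rpow (by norm_num) hT0.le, h₂] at h₁
    calc _ = A ^ 2 / 16 * (8 ^ (-(2 * γ)) *
          (κ ^ (2 * γ / (2 * γ + 1)) * (1 / X) ^ (2 * γ / (2 * γ + 1)))) := by ring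
      _ ≤ _ := by gcongr

/-- The constant in the lower bound for a single coefficient function. -/
def lowerConst (c₁ R γ : ℝ) : ℝ :=
  (8 : ℝ) ^ (-(2 * γ)) / 16 * (c₁ / (12 * (R ^ 2 + 1))) ^ (2 * γ / (2 * γ + 1))

lemma lowerConst_pos {c₁ : ℝ} (hc₁ : 0 < c₁) (R γ : ℝ) : 0 < lowerConst c₁ R γ := by
  unfold lowerConst
  positivity

lemma ofReal_lowerConst_mul_le_minimaxRisk {r n : ℕ} (hn : 0 < n)
    {ν : Measure (ℝ × (Fin r → ℝ))} [IsProbabilityMeasure ν]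
    {R : ℝ} (hR : ∀ᵐ p ∂ν, ∀ l, |p.2 l| ≤ R) {m : Measure ℝ} [SFinite m] {e : ℕ → ℝ → ℝ}
    (hem : ∀ k, Measurable (e k)) (he : ∀ k, MemLp (e k) 2 m)
    (hon : ∀ j k, ∫ t, e j t * e k t ∂m = if j = k then 1 else 0)
    (hτ : ∀ k, ∫⁻ t, ENNReal.ofReal ((e (k + 1) t - e k t) ^ 2) ∂ν.map Prod.fst ≤ 2)
    {S : Matrix (Fin n) (Fin n) ℝ} (hS : S.PosSemidef) {α c₁ : ℝ} (hc₁ : 0 < c₁)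
    (hev : ∀ x : ℝ, Module.End.HasEigenvalue (Matrix.toLin' S) x → c₁ * (n : ℝ) ^ (1 - α) ≤ x)
    {σ : ℝ} (hσ : 0 < σ) {γ A : Fin r → ℝ} (l : Fin r) (hγ : 0 < γ l) (hA : 0 < A l)
    (hlarge : c₁ / (12 * (R ^ 2 + 1)) ≤ A l ^ 2 * (n : ℝ) ^ α / σ ^ 2) :
    ENNReal.ofReal (lowerConst c₁ R (γ l) *
        (A l ^ 2 * (σ ^ 2 / (A l ^ 2 * (n : ℝ) ^ α)) ^ (2 * γ l / (2 * γ l + 1)))) ≤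
      minimaxRisk m n ν S σ {β | ∀ l, β l ∈ sobolevBall m e (γ l) (A l)} := by
  have hn' : (0 : ℝ) < n := by exact_mod_cast hn
  -- Here `X` is the signal-to-noise ratio `A² n^α / σ²`; in `κ` the `12` combines the `6` of the
  -- two-point bound with `∫ ψ² h ≤ 2`, and `R² + 1` avoids dividing by zero.
  obtain ⟨M, δ, h₁, h₂, h₃⟩ := exists_level_amplitude (A := A l) hγ
    (show 0 < c₁ / (12 * (R ^ 2 + 1)) by positivity)
    (show 0 < A l ^ 2 * (n : ℝ) ^ α / σ ^ 2 by positivity) hlarge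
  rw [one_div_div] at h₃
  refine (ENNReal.ofReal_le_ofReal h₃).trans
    (ofReal_le_minimaxRisk hR hem he hon hτ hS (by positivity) hev hσ l hγ h₁ ?_)
  have hpow : (n : ℝ) ^ (1 - α) * (n : ℝ) ^ α = n := by
    rw [← Real.rpow_add hn']
    simp
  have hR1 : R ^ 2 ≤ R ^ 2 + 1 := by linarith
  calc (n : ℝ) * (2 * (δ ^ 2 * R ^ 2))
      ≤ n * (2 * (A l ^ 2 * (c₁ / (12 * (R ^ 2 + 1))) / (A l ^ 2 * (n : ℝ) ^ α / σ ^ 2) *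
          (R ^ 2 + 1))) := by gcongr
    _ = ((n : ℝ) ^ (1 - α) * (n : ℝ) ^ α) * (2 * (A l ^ 2 * (c₁ / (12 * (R ^ 2 + 1))) /
          (A l ^ 2 * (n : ℝ) ^ α / σ ^ 2) * (R ^ 2 + 1))) := by rw [hpow]
    _ = c₁ * (n : ℝ) ^ (1 - α) * σ ^ 2 / 6 := by
        have h4 : (n : ℝ) ^ α ≠ 0 := by positivity
        field_simp
        norm_num

lemma ofReal_mul_sum_le {r : ℕ} {C : ℝ} {K w : Fin r → ℝ} (hw : ∀ l, 0 ≤ w l)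
    (hCK : ∀ l, C * r ≤ K l) {V : ℝ≥0∞} (h : ∀ l, ENNReal.ofReal (K l * w l) ≤ V) :
    ENNReal.ofReal (C * ∑ l, w l) ≤ V := by
  by_cases hV : V = ∞
  · simp [hV]
  rw [ENNReal.ofReal_le_iff_le_toReal hV]
  have h₁ : ∀ l, C * r * w l ≤ V.toReal := fun l =>
    (mul_le_mul_of_nonneg_right (hCK l) (hw l)).trans
      ((ENNReal.ofReal_le_iff_le_toReal hV).1 (h l))
  rcases Nat.eq_zero_or_pos r with rfl | hr
  · simp
  have hr' : (0 : ℝ) < r := by exact_mod_cast hr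
  have h₂ : ∑ l, C * r * w l ≤ r * V.toReal := by
    simpa using Finset.sum_le_sum fun l (_ : l ∈ Finset.univ) => h₁ l
  rw [← Finset.mul_sum] at h₂
  refine le_of_mul_le_mul_left ?_ hr'
  linarith

instance : SFinite halfLine := by unfold halfLine; infer_instance

instance (h : ℝ → ℝ) : SFinite (timeLaw h) := by unfold timeLaw; infer_instance

lemma lintegral_sq_sub_le_two {m : Measure ℝ} {e : ℕ → ℝ → ℝ} (he : ∀ k, MemLp (e k) 2 m)
    (hon : ∀ j k, ∫ t, e j t * e k t ∂m = if j = k then 1 else 0) (k : ℕ) :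
    ∫⁻ t, ENNReal.ofReal ((e (k + 1) t - e k t) ^ 2) ∂m ≤ 2 := by
  have hd : MemLp (fun t => e (k + 1) t - e k t) 2 m := (he _).sub (he _)
  rw [← ofReal_integral_eq_lintegral_ofReal hd.integrable_sq (ae_of_all _ fun t => sq_nonneg _)]
  simp_rw [sq]
  rw [integral_sub_mul_of_memLp (he _) (he _) hd]
  simp_rw [mul_comm (e _ _) (e _ _ - e _ _)]
  rw [integral_sub_mul_of_memLp (he _) (he _) (he _),
    integral_sub_mul_of_memLp (he _) (he _) (he _)]
  simp_rw [hon]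
  norm_num

/-- Here the system is orthonormal for `dt`, not for `h dt`; the pointwise bound on increments
compensates, whatever the density. -/
lemma lintegral_sq_laguerreFun_sub_le_two {h : ℝ → ℝ} [IsProbabilityMeasure (timeLaw h)] (k : ℕ) :
    ∫⁻ t, ENNReal.ofReal ((laguerreFun (k + 1) t - laguerreFun k t) ^ 2) ∂timeLaw h ≤ 2 := by
  have hpos : ∀ᵐ t ∂timeLaw h, 0 < t :=
    (withDensity_absolutelyContinuous _ _).ae_le (ae_restrict_mem measurableSet_Ioi)
  calc _ ≤ ∫⁻ _, 1 ∂timeLaw h := by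
        refine lintegral_mono_ae ?_
        filter_upwards [hpos] with t ht
        exact ENNReal.ofReal_le_one.2 (sq_laguerreFun_succ_sub_le_one k ht.le)
    _ = 1 := by simp
    _ ≤ 2 := by norm_num

end VaryingCoeff

end

/-! ### The minimax lower bounds -/

theorem mainTheorem1 (r : ℕ) (hr : 2 ≤ r) (γ : Fin r → ℝ) (hγ : ∀ l, 0 < γ l)
    (α c₁ c₂ : ℝ) (hα0 : 0 < α) (hα1 : α ≤ 1) (hc₁ : 0 < c₁) (hc₂ : c₁ ≤ c₂)
    (R ω₀ ω₁ : ℝ) (hω₀ : 0 < ω₀) :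
    ∃ C : ℝ, 0 < C ∧
      ∀ (h : ℝ → ℝ) (ν : Measure (ℝ × (Fin r → ℝ))),
        VaryingCoeff.IsDesignLaw ν h R ω₀ ω₁ →
      ∀ S : (n : ℕ) → Matrix (Fin n) (Fin n) ℝ, VaryingCoeff.IsLongMemory S α c₁ c₂ →
      ∀ (σ : ℝ) (A : Fin r → ℝ), 0 < σ → (∀ l, 0 < A l) →
      ∀ᶠ n : ℕ in atTop,
        ENNReal.ofReal (C * VaryingCoeff.rate γ A α σ n) ≤
            VaryingCoeff.minimaxRisk (VaryingCoeff.timeLaw h) n ν (S n) σ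
              {β | ∀ l, β l ∈ VaryingCoeff.sobolevBall (VaryingCoeff.timeLaw h)
                (VaryingCoeff.laguerreFunTilde h) (γ l) (A l)} ∧
        ENNReal.ofReal (C * VaryingCoeff.rate γ A α σ n) ≤
            VaryingCoeff.minimaxRisk VaryingCoeff.halfLine n ν (S n) σ
              {β | ∀ l, β l ∈ VaryingCoeff.sobolevBall VaryingCoeff.halfLine
                VaryingCoeff.laguerreFun (γ l) (A l)} := by
  have hr0 : 0 < r := by omega
  have : Nonempty (Fin r) := ⟨⟨0, hr0⟩⟩
  have hr' : (0 : ℝ) < r := by exact_mod_cast hr0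
  set K : Fin r → ℝ := fun l => VaryingCoeff.lowerConst c₁ R (γ l) with hK
  obtain ⟨l₀, hl₀⟩ := Finite.exists_min K
  have hK0 : 0 < K l₀ := VaryingCoeff.lowerConst_pos hc₁ R _
  refine ⟨K l₀ / r, by positivity, fun h ν hν S hS σ A hσ hA => ?_⟩
  have := hν.isProbability
  have hτ : IsProbabilityMeasure (VaryingCoeff.timeLaw h) := by
    rw [← hν.law_time]
    exact Measure.isProbabilityMeasure_map measurable_fst.aemeasurable
  have hCK : ∀ l, K l₀ / r * r ≤ K l := fun l => by
    rw [div_mul_cancel₀ _ hr'.ne']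
    exact hl₀ l
  -- Besides `n > 0`, `n` is taken large only to make the resolution level at least `1` for every
  -- `l`; this threshold may depend on `σ` and `A`, the constant does not.
  have hlarge : ∀ᶠ n : ℕ in atTop, ∀ l,
      c₁ / (12 * (R ^ 2 + 1)) ≤ A l ^ 2 * (n : ℝ) ^ α / σ ^ 2 := by
    refine eventually_all.2 fun l => ?_
    have h₁ : Tendsto (fun n : ℕ => (n : ℝ) ^ α) atTop atTop :=
      (tendsto_rpow_atTop hα0).comp tendsto_natCast_atTop_atTop
    have hAl : 0 < A l ^ 2 := pow_pos (hA l) 2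
    exact ((h₁.const_mul_atTop hAl).atTop_div_const (by positivity)).eventually_ge_atTop _
  filter_upwards [hlarge, eventually_gt_atTop 0] with n hn hn0
  have hw : ∀ l, 0 ≤ A l ^ 2 *
      (σ ^ 2 / (A l ^ 2 * (n : ℝ) ^ α)) ^ (2 * γ l / (2 * γ l + 1)) := fun l => by positivity
  have hev := fun x hx => ((hS n).2 x hx).1
  have hmem := VaryingCoeff.memLp_laguerreFunTilde hν.measurable_density hν.density_pos
  have hort := VaryingCoeff.integral_laguerreFunTilde_mul hν.measurable_density hν.density_pos
  refine ⟨VaryingCoeff.ofReal_mul_sum_le hw hCK fun l => ?_,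
    VaryingCoeff.ofReal_mul_sum_le hw hCK fun l => ?_⟩
  · refine VaryingCoeff.ofReal_lowerConst_mul_le_minimaxRisk hn0 hν.bounded
      (VaryingCoeff.measurable_laguerreFunTilde hν.measurable_density) hmem hort (fun k => ?_)
      (hS n).1 hc₁ hev hσ l (hγ l) (hA l) (hn l)
    rw [hν.law_time]
    exact VaryingCoeff.lintegral_sq_sub_le_two hmem hort k
  · refine VaryingCoeff.ofReal_lowerConst_mul_le_minimaxRisk hn0 hν.bounded
      VaryingCoeff.measurable_laguerreFun VaryingCoeff.memLp_laguerreFun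
      VaryingCoeff.integral_laguerreFun_mul (fun k => ?_)
      (hS n).1 hc₁ hev hσ l (hγ l) (hA l) (hn l)
    rw [hν.law_time]
    exact VaryingCoeff.lintegral_sq_laguerreFun_sub_le_two k
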